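/- Let $(\Omega,\mathscr F,\mathsf P)$ be a probability space and $\gamma$ a random variable with values in $[0,+\infty]$ and $\mathsf P(\gamma>0)>0$. Put $G(t)=\mathsf P(\gamma\le t)$, $t_G=\sup\{t\in\mathbb R_+ : G(t)<1\}$ and $\mathcal T=\{t\in\mathbb R_+ : \mathsf P(\gamma\ge t)>0\}$. Case A means $\mathsf P(\gamma=t_G<\infty)=0$, Case B means $\mathsf P(\gamma=t_G<\infty)>0$. Let $\mathbb F=(\mathscr F_t)_{t\in\mathbb R_+}$ be the single jump filtration generated by $\gamma$ and $\mathscr F$: $\mathscr F_t$ consists of all $A\in\mathscr F$ such that $A\cap\{t<\gamma\}$ is either $\varnothing$ or $\{t<\gamma\}$. No completion is made; all notions refer to $\mathbb F$, all processes are real-valued, and the predictable $\sigma$-field on $\mathbb R_+\times\Omega$ is generated by the sets $\{0\}\times A$, $A\in\mathscr F_0$, and $(s,\infty)\times A$, $A\in\mathscr F_s$. A process with finite variation is an adapted process almost all of whose paths are càdlàg and of finite variation on compact intervals. A uniformly integrable martingale is understood to have almost all paths càdlàg. A local martingale is an adapted process $X$ with almost all paths càdlàg such that, for some stopping times $T_n\uparrow\infty$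 a.s., every $X^{T_n}$ is (indistinguishable from) a uniformly integrable martingale. A semimartingale is the sum of a local martingale and a process with finite variation. A $\sigma$-martingale is a semimartingale $X$ for which there are predictable sets $\Sigma_1\subseteq\Sigma_2\subseteq\dots$ with union $\mathbb R_+\times\Omega$ such that each stochastic integral $\int_{(0,\cdot]}\mathbf 1_{\Sigma_n}\,dX$ is a uniformly integrable martingale. (i) If $X$ is an adapted process, then there is a deterministic function $F(t)$, $0\le t<t_G$, such that $X_t=F(t)$ on $\{t<\gamma\wedge t_G\}$. If $Y$ is another adapted process and $\mathsf P(X_t=Y_t)=1$ for every $t\in\mathbb R_+$, then $X_t=Y_t$ identically on $\{t<\gamma\wedge t_G\}$. (ii) If $Y$ is a predictable process, then there is a measurable deterministic function $C(t)$, $t\in\mathcal T$, such that $Y_t=C(t)$ on $\{t\le\gamma,\ \gamma>0\}$ for every $t\in\mathcal T$. (iii) If $X$ is a process with finite variation, then the function $F$ in (i) is càdlàg on $[0,t_G)$ and has finite variation over $[0,t]$ for every $t<t_G$ in Case A, and over $[0,t_G)$ in Case B. (iv) Every semimartingale is a process with finite variation. (v) If $M$ is a $\sigma$-martingale, then there are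 a deterministic function $F(t)$, $t\in\mathbb R_+$, and a finite random variable $L$ such that, up to indistinguishability, $$M_t=F(t)\mathbf 1_{\{t<\gamma\}}+L\,\mathbf 1_{\{t\ge\gamma\}},$$ where $F$ is càdlàg on $[0,t_G)$ and has finite variation over $[0,t]$ for every $t<t_G$ in Case A, and over $[0,t_G)$ in Case B. -/

import Mathlib

open MeasureTheory ProbabilityTheory Filter Set
open scoped NNReal ENNReal Topology

namespace SingleJump

variable {Ω : Type*} {m : MeasurableSpace Ω}

/-! ### The single jump filtration -/

/-- The single jump filtration generated by `γ` and the ambient `σ`-field: `A` belongs to the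
`σ`-field at time `t` iff `A` is measurable and `A ∩ {t < γ}` is either `∅` or `{t < γ}`. -/
def filtration (m : MeasurableSpace Ω) (γ : Ω → ℝ≥0∞) : Filtration ℝ≥0 m where
  seq t :=
    { MeasurableSet' := fun A => MeasurableSet A ∧
        (A ∩ {ω | (t : ℝ≥0∞) < γ ω} = ∅ ∨
          A ∩ {ω | (t : ℝ≥0∞) < γ ω} = {ω | (t : ℝ≥0∞) < γ ω})
      measurableSet_empty := ⟨MeasurableSet.empty, Or.inl (empty_inter _)⟩
      measurableSet_compl := by
        rintro A ⟨hA, h⟩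
        refine ⟨hA.compl, ?_⟩
        rcases h with h | h
        · right
          rw [inter_eq_right]
          intro ω hω hA'
          exact (h ▸ (⟨hA', hω⟩ : ω ∈ A ∩ {ω | (t : ℝ≥0∞) < γ ω}) : ω ∈ (∅ : Set Ω))
        · left
          rw [inter_eq_right] at h
          ext ω
          simp only [mem_inter_iff, mem_compl_iff, mem_empty_iff_false, iff_false, not_and]
          exact fun h1 h2 => h1 (h h2)
      measurableSet_iUnion := by
        intro f hf
        refine ⟨MeasurableSet.iUnion fun i => (hf i).1, ?_⟩
        by_cases h : ∃ i, f i ∩ {ω | (t : ℝ≥0∞) < γ ω} = {ω | (t : ℝ≥0∞) < γ ω}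
        · right
          obtain ⟨i, hi⟩ := h
          rw [inter_eq_right] at hi ⊢
          exact hi.trans (subset_iUnion f i)
        · left
          rw [iUnion_inter, iUnion_eq_empty]
          exact fun i => (hf i).2.resolve_right fun hi => h ⟨i, hi⟩ }
  mono' := by
    intro s t hst A hA
    have hsub : {ω | (t : ℝ≥0∞) < γ ω} ⊆ {ω | (s : ℝ≥0∞) < γ ω} := fun ω hω =>
      lt_of_le_of_lt (ENNReal.coe_le_coe.2 hst) hω
    refine ⟨hA.1, ?_⟩
    rcases hA.2 with h | h
    · left
      exact subset_empty_iff.1 ((inter_subset_inter_right A hsub).trans h.subset)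
    · right
      rw [inter_eq_right] at h ⊢
      exact hsub.trans h
  le' := fun _ _ hA => hA.1

/-- The right endpoint `t_G = sup {t ∈ ℝ₊ : P(γ ≤ t) < 1}` of the distribution of `γ`. -/
noncomputable def rightEndpoint (P : Measure Ω) (γ : Ω → ℝ≥0∞) : ℝ≥0∞ :=
  sSup ((fun t : ℝ≥0 => (t : ℝ≥0∞)) '' {t : ℝ≥0 | P {ω | γ ω ≤ t} < 1})

/-- The time set `{t ∈ ℝ₊ : P(γ ≥ t) > 0}`. -/
def timeSet (P : Measure Ω) (γ : Ω → ℝ≥0∞) : Set ℝ≥0 :=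
  {t | 0 < P {ω | (t : ℝ≥0∞) ≤ γ ω}}

/-- Case A: `P(γ = t_G < ∞) = 0`. -/
def CaseA (P : Measure Ω) (γ : Ω → ℝ≥0∞) : Prop :=
  P {ω | γ ω = rightEndpoint P γ ∧ rightEndpoint P γ < ⊤} = 0

/-- Case B: `P(γ = t_G < ∞) > 0`. -/
def CaseB (P : Measure Ω) (γ : Ω → ℝ≥0∞) : Prop :=
  0 < P {ω | γ ω = rightEndpoint P γ ∧ rightEndpoint P γ < ⊤}

/-! ### Paths -/

/-- `f` is càdlàg on `[0, s)`: right-continuous at every `t < s`, with a finite left limit at every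
`t < s` (nothing is required at `t = 0`, where `𝓝[<] 0 = ⊥`). -/
def IsCadlagBelow (f : ℝ≥0 → ℝ) (s : ℝ≥0∞) : Prop :=
  ∀ t : ℝ≥0, (t : ℝ≥0∞) < s →
    ContinuousWithinAt f (Ici t) t ∧ ∃ l : ℝ, Tendsto f (𝓝[<] t) (𝓝 l)

/-- `f` is càdlàg on `[0, ∞)`. -/
def IsCadlag (f : ℝ≥0 → ℝ) : Prop := IsCadlagBelow f ⊤

/-- `F` is of finite variation on the intervals determined by the law of `γ`: it is càdlàg on
`[0, t_G)`, has finite variation over `[0, t]` for every `t < t_G` in Case A, and has finite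
variation over `[0, t_G)` in Case B. -/
def HasFiniteVariationBefore (P : Measure Ω) (γ : Ω → ℝ≥0∞) (F : ℝ≥0 → ℝ) : Prop :=
  IsCadlagBelow F (rightEndpoint P γ) ∧
  (CaseA P γ → ∀ t : ℝ≥0, (t : ℝ≥0∞) < rightEndpoint P γ → BoundedVariationOn F (Icc 0 t)) ∧
  (CaseB P γ → BoundedVariationOn F {t : ℝ≥0 | (t : ℝ≥0∞) < rightEndpoint P γ})

/-! ### Classes of processes, for an arbitrary (possibly incomplete) filtration -/

/-- Two processes are indistinguishable. -/
def Indistinguishable (P : Measure Ω) (X Y : ℝ≥0 → Ω → ℝ) : Prop :=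
  ∀ᵐ ω ∂P, ∀ t, X t ω = Y t ω

/-- A process with finite variation: adapted, and almost all paths are càdlàg and have finite
variation on compact intervals. -/
def IsFiniteVariationProcess (𝓕 : Filtration ℝ≥0 m) (P : Measure Ω) (X : ℝ≥0 → Ω → ℝ) : Prop :=
  StronglyAdapted 𝓕 X ∧
  ∀ᵐ ω ∂P, IsCadlag (fun t => X t ω) ∧ ∀ t : ℝ≥0, BoundedVariationOn (fun s => X s ω) (Icc 0 t)

/-- A uniformly integrable martingale with almost all paths càdlàg. -/
def IsUIMartingale (𝓕 : Filtration ℝ≥0 m) (P : Measure Ω) (X : ℝ≥0 → Ω → ℝ) : Prop :=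
  Martingale X 𝓕 P ∧ UniformIntegrable X 1 P ∧ ∀ᵐ ω ∂P, IsCadlag (fun t => X t ω)

/-- A local martingale: an adapted process with almost all paths càdlàg for which there are stopping
times `T n` increasing to `∞` almost surely such that every stopped process is a uniformly
integrable martingale. As the filtration need not be complete and paths are regular only almost
surely, the latter is understood up to indistinguishability. -/
def IsLocalMartingale (𝓕 : Filtration ℝ≥0 m) (P : Measure Ω) (X : ℝ≥0 → Ω → ℝ) : Prop :=
  StronglyAdapted 𝓕 X ∧ (∀ᵐ ω ∂P, IsCadlag (fun t => X t ω)) ∧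
  ∃ T : ℕ → Ω → WithTop ℝ≥0, IsLocalizingSequence 𝓕 T P ∧
    ∀ n, ∃ N : ℝ≥0 → Ω → ℝ, IsUIMartingale 𝓕 P N ∧ Indistinguishable P N (stoppedProcess X (T n))

/-- A semimartingale: the sum of a local martingale and a process with finite variation. -/
def IsSemimartingale (𝓕 : Filtration ℝ≥0 m) (P : Measure Ω) (X : ℝ≥0 → Ω → ℝ) : Prop :=
  ∃ M A : ℝ≥0 → Ω → ℝ, IsLocalMartingale 𝓕 P M ∧ IsFiniteVariationProcess 𝓕 P A ∧
    ∀ t ω, X t ω = M t ω + A t ω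

/-- `Y n → Z` uniformly on compact time intervals in probability. -/
def TendstoUCP (P : Measure Ω) (Y : ℕ → ℝ≥0 → Ω → ℝ) (Z : ℝ≥0 → Ω → ℝ) : Prop :=
  ∀ t : ℝ≥0, ∀ ε : ℝ, 0 < ε →
    Tendsto (fun n => P {ω | ∃ s ≤ t, ε ≤ |Y n s ω - Z s ω|}) atTop (𝓝 0)

/-- The indicator function of a set `S ⊆ ℝ₊ × Ω`, as a process. -/
noncomputable def indicatorProcess (S : Set (ℝ≥0 × Ω)) : ℝ≥0 → Ω → ℝ :=
  fun t ω => S.indicator (fun _ => (1 : ℝ)) (t, ω)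

/-- `IsStochIntegral 𝓕 P X H Y`: the process `Y` is (a version of) the stochastic integral `H · X`,
`Y t = ∫_(0,t] H dX`, of the bounded predictable process `H` with respect to the semimartingale `X`.
It is the closure of the elementary integrals (over the sets `{0} × A` with `A ∈ 𝓕 0` and `(s, ∞) × A`
with `A ∈ 𝓕 s`, which generate the predictable `σ`-field) under linear combinations and under
bounded pointwise limits of the integrands, with convergence of the integrals uniformly on compacts
in probability. -/
inductive IsStochIntegral (𝓕 : Filtration ℝ≥0 m) (P : Measure Ω) (X : ℝ≥0 → Ω → ℝ) :
    (ℝ≥0 → Ω → ℝ) → (ℝ≥0 → Ω → ℝ) → Prop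
  | zero (A : Set Ω) (hA : MeasurableSet[𝓕 0] A) :
      IsStochIntegral 𝓕 P X (indicatorProcess ({0} ×ˢ A)) (fun _ _ => 0)
  | elementary (s : ℝ≥0) (A : Set Ω) (hA : MeasurableSet[𝓕 s] A) :
      IsStochIntegral 𝓕 P X (indicatorProcess (Ioi s ×ˢ A))
        (fun t ω => A.indicator (fun ω => X t ω - X (min t s) ω) ω)
  | add (H K Y Z : ℝ≥0 → Ω → ℝ) (hH : IsStochIntegral 𝓕 P X H Y)
      (hK : IsStochIntegral 𝓕 P X K Z) :
      IsStochIntegral 𝓕 P X (fun t ω => H t ω + K t ω) (fun t ω => Y t ω + Z t ω)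
  | smul (c : ℝ) (H Y : ℝ≥0 → Ω → ℝ) (hH : IsStochIntegral 𝓕 P X H Y) :
      IsStochIntegral 𝓕 P X (fun t ω => c * H t ω) (fun t ω => c * Y t ω)
  | limit (H Y : ℕ → ℝ≥0 → Ω → ℝ) (K Z : ℝ≥0 → Ω → ℝ) (C : ℝ)
      (hH : ∀ n, IsStochIntegral 𝓕 P X (H n) (Y n))
      (hC : ∀ n t ω, |H n t ω| ≤ C)
      (hK : ∀ t ω, Tendsto (fun n => H n t ω) atTop (𝓝 (K t ω)))
      (hZ : TendstoUCP P Y Z) :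
      IsStochIntegral 𝓕 P X K Z

/-- A `σ`-martingale: a semimartingale `X` for which there is an increasing sequence of predictable
sets `S n` with union `ℝ₊ × Ω` such that the integral process `1_{S n} · X` is a uniformly integrable
martingale for every `n`. -/
def IsSigmaMartingale (𝓕 : Filtration ℝ≥0 m) (P : Measure Ω) (X : ℝ≥0 → Ω → ℝ) : Prop :=
  IsSemimartingale 𝓕 P X ∧
  ∃ S : ℕ → Set (ℝ≥0 × Ω), Monotone S ∧ (⋃ n, S n) = univ ∧
    (∀ n, MeasurableSet[𝓕.predictable] (S n)) ∧
    ∀ n, ∃ Y : ℝ≥0 → Ω → ℝ, IsStochIntegral 𝓕 P X (indicatorProcess (S n)) Y ∧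
      IsUIMartingale 𝓕 P Y

end SingleJump

namespace SingleJump

variable {Ω : Type*} {m : MeasurableSpace Ω}

/-! ### Adapted and predictable processes -/

section Adapted

variable {P : Measure Ω} {γ : Ω → ℝ≥0∞}

/-! An event of the time-`t` σ-field cannot split `{t < γ}`, so before `γ` an adapted process
follows one deterministic curve `F`. Finite variation of `F` is read off a single good path, which
exists because the relevant event has positive probability.

Two facts about a uniformly integrable martingale `N` carry the rest. After `γ` it is constant,
since on `{γ ≤ s}` the past at time `s` already knows everything. Before `γ`, the martingale
property on `{t < γ}` gives `F t * P(γ > t) = ∫ N g` over `{t < γ}` for `t < g`; splitting `N g`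
into positive and negative parts exhibits `F` as a difference of bounded increasing functions when
`P(γ ≥ g) > 0` (`exists_monotoneOn_sub_of_martingale`). Hence `N` has finite variation, and
localization and addition pass this to semimartingales.

For a σ-martingale the integrals can therefore be computed path by path
(`IsStochIntegral.ae_eq_stieltjes`). Each is constant after `γ`, and dominated convergence along the
sets `S n` makes `M` constant after `γ` too. -/

theorem mem_iff_mem_of_measurableSet_filtration {t : ℝ≥0} {A : Set Ω}
    (hA : MeasurableSet[filtration m γ t] A) {ω ω' : Ω} (h : (t : ℝ≥0∞) < γ ω)
    (h' : (t : ℝ≥0∞) < γ ω') : ω ∈ A ↔ ω' ∈ A := by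
  rcases hA.2 with h0 | h0
  · have hn : ∀ x, (t : ℝ≥0∞) < γ x → x ∉ A := fun x hx hxA =>
      (h0 ▸ (⟨hxA, hx⟩ : x ∈ A ∩ {ω | (t : ℝ≥0∞) < γ ω}) : x ∈ (∅ : Set Ω))
    exact iff_of_false (hn ω h) (hn ω' h')
  · rw [inter_eq_right] at h0
    exact iff_of_true (h0 h) (h0 h')

theorem eq_of_measurable_filtration {t : ℝ≥0} {f : Ω → ℝ}
    (hf : Measurable[filtration m γ t] f) {ω ω' : Ω} (h : (t : ℝ≥0∞) < γ ω)
    (h' : (t : ℝ≥0∞) < γ ω') : f ω = f ω' := by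
  have hA : MeasurableSet[filtration m γ t] (f ⁻¹' {f ω'}) := hf (measurableSet_singleton _)
  exact (mem_iff_mem_of_measurableSet_filtration hA h h').2 rfl

/-- An adapted process is deterministic strictly before `γ`. -/
theorem exists_eq_before_of_adapted {X : ℝ≥0 → Ω → ℝ}
    (hX : StronglyAdapted (filtration m γ) X) :
    ∃ F : ℝ≥0 → ℝ, ∀ (t : ℝ≥0) (ω : Ω), (t : ℝ≥0∞) < γ ω → X t ω = F t := by
  classical
  refine ⟨fun t => if h : ∃ ω, (t : ℝ≥0∞) < γ ω then X t h.choose else 0, fun t ω hω => ?_⟩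
  have h : ∃ ω, (t : ℝ≥0∞) < γ ω := ⟨ω, hω⟩
  simp only [dif_pos h]
  exact eq_of_measurable_filtration (hX t).measurable hω h.choose_spec

theorem measure_lt_pos_of_lt_rightEndpoint [IsProbabilityMeasure P] (hγ : Measurable γ) {t : ℝ≥0}
    (ht : (t : ℝ≥0∞) < rightEndpoint P γ) : 0 < P {ω | (t : ℝ≥0∞) < γ ω} := by
  obtain ⟨_, ⟨s, hs, rfl⟩, hts⟩ := lt_sSup_iff.1 ht
  have h1 : P {ω | γ ω ≤ t} < 1 :=
    (measure_mono fun ω (hω : γ ω ≤ t) => hω.trans hts.le).trans_lt hs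
  have hm : MeasurableSet {ω | γ ω ≤ t} := measurableSet_le hγ measurable_const
  have h2 : {ω | (t : ℝ≥0∞) < γ ω} = {ω | γ ω ≤ t}ᶜ := by ext; simp
  rw [h2, prob_compl_eq_one_sub hm]
  exact tsub_pos_of_lt h1

/-- For `t < t_G` the event `{t < γ}` is not null, so it contains a point where the two variables
agree; both are constant on that event. -/
theorem eq_before_of_modification [IsProbabilityMeasure P] (hγ : Measurable γ)
    {X Y : ℝ≥0 → Ω → ℝ} (hX : StronglyAdapted (filtration m γ) X)
    (hY : StronglyAdapted (filtration m γ) Y) (hXY : ∀ t : ℝ≥0, ∀ᵐ ω ∂P, X t ω = Y t ω)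
    (t : ℝ≥0) (ω : Ω) (h : (t : ℝ≥0∞) < min (γ ω) (rightEndpoint P γ)) : X t ω = Y t ω := by
  obtain ⟨h1, h2⟩ := lt_min_iff.1 h
  have hfr : ∃ᵐ ω' ∂P, (t : ℝ≥0∞) < γ ω' :=
    frequently_ae_iff.2 (measure_lt_pos_of_lt_rightEndpoint hγ h2).ne'
  obtain ⟨ω', h3, h4⟩ := (hfr.and_eventually (hXY t)).exists
  rw [eq_of_measurable_filtration (hX t).measurable h1 h3, h4,
    eq_of_measurable_filtration (hY t).measurable h3 h1]

/-- A predictable process is deterministic up to and including `γ`, on `{γ > 0}`. -/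
theorem exists_eq_upto_of_predictable {Y : ℝ≥0 → Ω → ℝ}
    (hY : IsStronglyPredictable (filtration m γ) Y) :
    ∃ C : ℝ≥0 → ℝ, Measurable C ∧
      ∀ (t : ℝ≥0) (ω : Ω), (t : ℝ≥0∞) ≤ γ ω → 0 < γ ω → Y t ω = C t := by
  -- Give the set `{t ≤ γ, γ > 0}` the σ-field pulled back from time alone. Each generator of the
  -- predictable σ-field traces there a pure time set or `∅`, so `Y` is measurable for it and
  -- factors through time.
  let D := {p : ℝ≥0 × Ω // (p.1 : ℝ≥0∞) ≤ γ p.2 ∧ 0 < γ p.2}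
  let f : D → ℝ≥0 := fun p => p.1.1
  let mD : MeasurableSpace D := MeasurableSpace.comap f inferInstance
  have hf : Measurable f := comap_measurable f
  have hval : @Measurable D (ℝ≥0 × Ω) mD (filtration m γ).predictable (fun p => p.1) := by
    refine @measurable_generateFrom _ _ mD _ _ ?_
    rintro _ (⟨A, hA, rfl⟩ | ⟨s, A, hA, rfl⟩)
    · by_cases hne : ∃ ω ∈ A, 0 < γ ω
      · obtain ⟨ω, hωA, hω⟩ := hne
        convert hf (measurableSet_singleton (0 : ℝ≥0)) using 1
        ext p
        simp only [mem_preimage, mem_prod, mem_singleton_iff, bot_eq_zero', f]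
        refine ⟨fun h => h.1, fun h => ⟨h, ?_⟩⟩
        refine (mem_iff_mem_of_measurableSet_filtration hA (ω := ω) (ω' := p.1.2) ?_ ?_).1 hωA
        · simpa using hω
        · simpa using p.2.2
      · convert @MeasurableSet.empty D mD using 1
        ext p
        simp only [mem_preimage, mem_prod, mem_empty_iff_false, iff_false, not_and]
        exact fun _ h => hne ⟨_, h, p.2.2⟩
    · by_cases hne : ∃ ω ∈ A, (s : ℝ≥0∞) < γ ω
      · obtain ⟨ω, hωA, hω⟩ := hne
        convert hf (measurableSet_Ioi (a := s)) using 1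
        ext p
        simp only [mem_preimage, mem_prod, mem_Ioi, f]
        refine ⟨fun h => h.1, fun h => ⟨h, ?_⟩⟩
        refine (mem_iff_mem_of_measurableSet_filtration hA hω ?_).1 hωA
        exact (ENNReal.coe_lt_coe.2 h).trans_le p.2.1
      · convert @MeasurableSet.empty D mD using 1
        ext p
        simp only [mem_preimage, mem_prod, mem_empty_iff_false, iff_false, not_and, mem_Ioi]
        exact fun h h' => hne ⟨_, h', (ENNReal.coe_lt_coe.2 h).trans_le p.2.1⟩
  have hg : @Measurable D ℝ mD _ (fun p => Y p.1.1 p.1.2) :=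
    (StronglyMeasurable.measurable hY).comp hval
  obtain ⟨C, hC, h⟩ := hg.exists_eq_measurable_comp
  exact ⟨C, hC, fun t ω h1 h2 => congrFun h ⟨(t, ω), h1, h2⟩⟩

/-! ### Processes with finite variation -/

theorem IsCadlagBelow.congr {f g : ℝ≥0 → ℝ} {s : ℝ≥0∞} (hf : IsCadlagBelow f s)
    (h : ∀ t : ℝ≥0, (t : ℝ≥0∞) < s → g t = f t) : IsCadlagBelow g s := by
  intro t ht
  have hev : ∀ᶠ u : ℝ≥0 in 𝓝 t, (u : ℝ≥0∞) < s :=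
    ENNReal.continuous_coe.continuousAt.eventually (eventually_lt_nhds ht)
  obtain ⟨h1, l, h2⟩ := hf t ht
  refine ⟨h1.congr_of_eventuallyEq ?_ (h t ht), l, h2.congr' ?_⟩
  · exact (hev.filter_mono nhdsWithin_le_nhds).mono fun u hu => h u hu
  · exact (hev.filter_mono nhdsWithin_le_nhds).mono fun u hu => (h u hu).symm

theorem hasFiniteVariationBefore_of_isFiniteVariationProcess [IsProbabilityMeasure P]
    (hγ : Measurable γ) {X : ℝ≥0 → Ω → ℝ}
    (hX : IsFiniteVariationProcess (filtration m γ) P X) {F : ℝ≥0 → ℝ}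
    (hF : ∀ (t : ℝ≥0) (ω : Ω),
      (t : ℝ≥0∞) < min (γ ω) (rightEndpoint P γ) → X t ω = F t) :
    HasFiniteVariationBefore P γ F := by
  have key : ∀ t : ℝ≥0, (t : ℝ≥0∞) < rightEndpoint P γ →
      ∃ ω, (t : ℝ≥0∞) < γ ω ∧ IsCadlag (fun t => X t ω) ∧
        ∀ t : ℝ≥0, BoundedVariationOn (fun s => X s ω) (Icc 0 t) := fun t ht =>
    ((frequently_ae_iff.2 (measure_lt_pos_of_lt_rightEndpoint hγ ht).ne').and_eventually
      hX.2).exists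
  refine ⟨fun t ht => ?_, fun _ t ht => ?_, fun hB => ?_⟩
  · obtain ⟨ω, h1, h2, -⟩ := key t ht
    have h3 : IsCadlagBelow F (min (γ ω) (rightEndpoint P γ)) :=
      IsCadlagBelow.congr (f := fun t => X t ω) (fun u _ => h2 u ENNReal.coe_lt_top)
        fun u hu => (hF u ω hu).symm
    exact h3 t (lt_min h1 ht)
  · obtain ⟨ω, h1, -, h2⟩ := key t ht
    unfold BoundedVariationOn
    rw [← eVariationOn.congr (f := fun s => X s ω)]
    · exact h2 t
    · exact fun u hu => hF u ω ((ENNReal.coe_le_coe.2 hu.2).trans_lt (lt_min h1 ht))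
  -- In Case B some good path has `γ ω = t_G < ∞`: it follows `F` on all of `[0, t_G)`, and its
  -- variation over the compact `[0, t_G]` is finite.
  · obtain ⟨ω, ⟨h1, h1'⟩, -, h2⟩ := ((frequently_ae_iff.2 hB.ne').and_eventually hX.2).exists
    lift rightEndpoint P γ to ℝ≥0 using h1'.ne with g hg
    unfold BoundedVariationOn
    rw [← eVariationOn.congr (f := fun s => X s ω)]
    · refine (h2 g).mono fun u hu => ⟨zero_le, ?_⟩
      exact (ENNReal.coe_lt_coe.1 hu).le
    · exact fun u hu => hF u ω (by rw [h1, min_self]; exact hu)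

end Adapted

/-! ### Functions of bounded variation -/

theorem boundedVariationOn_add {f g : ℝ≥0 → ℝ} {s : Set ℝ≥0} (hf : BoundedVariationOn f s)
    (hg : BoundedVariationOn g s) : BoundedVariationOn (fun t => f t + g t) s := by
  have h : eVariationOn (fun t => f t + g t) s ≤ eVariationOn f s + eVariationOn g s := by
    refine iSup_le fun ⟨n, u, hu, us⟩ => ?_
    calc ∑ i ∈ Finset.range n, edist (f (u (i + 1)) + g (u (i + 1))) (f (u i) + g (u i))
        ≤ ∑ i ∈ Finset.range n, (edist (f (u (i + 1))) (f (u i)) +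
            edist (g (u (i + 1))) (g (u i))) :=
          Finset.sum_le_sum fun i _ => edist_add_add_le _ _ _ _
      _ ≤ _ := by
          rw [Finset.sum_add_distrib]
          exact add_le_add (eVariationOn.sum_le hu us) (eVariationOn.sum_le hu us)
  exact ne_top_of_le_ne_top (ENNReal.add_ne_top.2 ⟨hf, hg⟩) h

theorem boundedVariationOn_of_monotoneOn_sub {f p q : ℝ≥0 → ℝ} {s : Set ℝ≥0} {C : ℝ}
    (hp : MonotoneOn p s) (hq : MonotoneOn q s) (hpC : ∀ t ∈ s, |p t| ≤ C)
    (hqC : ∀ t ∈ s, |q t| ≤ C) (hf : ∀ t ∈ s, f t = p t - q t) : BoundedVariationOn f s := by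
  have hq' : BoundedVariationOn (fun t => (-1 : ℝ) * q t) s :=
    BoundedVariationOn.fun_mul (f := fun _ => (-1 : ℝ))
      (monotoneOn_const.boundedVariationOn (C := 1) (by simp)) (hq.boundedVariationOn hqC)
  have h := boundedVariationOn_add (hp.boundedVariationOn hpC) hq'
  unfold BoundedVariationOn at h ⊢
  rwa [eVariationOn.congr (g := fun t => p t + -1 * q t)]
  intro t ht
  simp only [hf t ht]
  ring

theorem IsCadlag.add {f g : ℝ≥0 → ℝ} (hf : IsCadlag f) (hg : IsCadlag g) :
    IsCadlag (fun t => f t + g t) := by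
  intro t ht
  obtain ⟨h1, l, h2⟩ := hf t ht
  obtain ⟨h3, l', h4⟩ := hg t ht
  exact ⟨h1.add h3, l + l', h2.add h4⟩

/-- A function which is the difference of bounded monotone functions on `[0, g)` and constant on
`[g, T]` has bounded variation on `[0, T]`. -/
theorem boundedVariationOn_of_monotoneOn_sub_of_const {f p q : ℝ≥0 → ℝ} {g T : ℝ≥0} {C : ℝ}
    (hp : MonotoneOn p (Iio g)) (hq : MonotoneOn q (Iio g)) (hpC : ∀ t < g, |p t| ≤ C)
    (hqC : ∀ t < g, |q t| ≤ C) (hf : ∀ t < g, f t = p t - q t)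
    (hg : ∀ t, g ≤ t → t ≤ T → f t = f g) : BoundedVariationOn f (Icc 0 T) := by
  classical
  -- From `g` on, `p` and `q` are continued by `C + (f g)⁺` and `C + (f g)⁻`: the shift `C`
  -- dominates their earlier values, so monotonicity survives, and it cancels in the difference.
  have ext_mono : ∀ (r : ℝ≥0 → ℝ) (c : ℝ), MonotoneOn r (Iio g) → (∀ t < g, |r t| ≤ C) → 0 ≤ c →
      MonotoneOn (fun t => if t < g then r t else C + c) (Icc 0 T) := by
    intro r c hr hrC hc s _ t _ hst
    by_cases ht : t < g
    · simp only [ht, hst.trans_lt ht, if_true]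
      exact hr (hst.trans_lt ht) ht hst
    · by_cases hs : s < g
      · simp only [ht, hs, if_true, if_false]
        have := (abs_le.1 (hrC s hs)).2
        linarith
      · simp only [ht, hs, if_false, le_refl]
  have ext_bdd : ∀ (r : ℝ≥0 → ℝ) (c : ℝ), (∀ t < g, |r t| ≤ C) → 0 ≤ c → c ≤ |f g| →
      ∀ t ∈ Icc 0 T, |if t < g then r t else C + c| ≤ |C| + |f g| := by
    intro r c hrC hc hc' t _
    split_ifs with h
    · exact (hrC t h).trans ((le_abs_self C).trans (le_add_of_nonneg_right (abs_nonneg _)))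
    · exact (abs_add_le _ _).trans (add_le_add le_rfl (by rwa [abs_of_nonneg hc]))
  refine boundedVariationOn_of_monotoneOn_sub
    (ext_mono p (max (f g) 0) hp hpC (le_max_right _ _))
    (ext_mono q (max (-f g) 0) hq hqC (le_max_right _ _))
    (ext_bdd p (max (f g) 0) hpC (le_max_right _ _) (max_le (le_abs_self _) (abs_nonneg _)))
    (ext_bdd q (max (-f g) 0) hqC (le_max_right _ _) (max_le (neg_le_abs _) (abs_nonneg _)))
    fun t ht => ?_
  by_cases h : t < g
  · simp only [h, if_true, hf t h]
  · simp only [h, if_false]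
    rw [hg t (not_lt.1 h) ht.2]
    have := max_zero_sub_eq_self (f g)
    linarith

/-! ### Uniformly integrable martingales -/

section Martingale

variable {P : Measure Ω} [IsProbabilityMeasure P] {γ : Ω → ℝ≥0∞}

/-- The truncated function vanishes on `{t < γ}`, so its preimages contain or miss that event
according to whether they come from a set containing `0`. -/
theorem stronglyMeasurable_indicator_le (hγ : Measurable γ) (t : ℝ≥0) {f : Ω → ℝ}
    (hf : Measurable f) :
    StronglyMeasurable[filtration m γ t] ({ω | γ ω ≤ t}.indicator f) := by
  refine @Measurable.stronglyMeasurable Ω ℝ _ (filtration m γ t) _ _ _ _ _ ?_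
  have hm : MeasurableSet {ω | γ ω ≤ t} := measurableSet_le hγ measurable_const
  intro B hB
  refine ⟨(hf.indicator hm) hB, ?_⟩
  by_cases h0 : (0 : ℝ) ∈ B
  · right
    rw [inter_eq_right]
    intro ω hω
    have : ω ∉ {ω | γ ω ≤ t} :=
      fun h' => (show (t : ℝ≥0∞) < γ ω from hω).not_ge h'
    simpa [indicator_of_notMem this] using h0
  · left
    ext ω
    simp only [mem_inter_iff, mem_preimage, mem_empty_iff_false, iff_false, not_and]
    intro h hω
    have : ω ∉ {ω | γ ω ≤ t} :=
      fun h' => (show (t : ℝ≥0∞) < γ ω from hω).not_ge h'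
    rw [indicator_of_notMem this] at h
    exact h0 h

theorem measurableSet_filtration_le (hγ : Measurable γ) (t : ℝ≥0) :
    MeasurableSet[filtration m γ t] {ω | γ ω ≤ t} := by
  refine ⟨measurableSet_le hγ measurable_const, Or.inl ?_⟩
  ext ω
  simp

theorem measurableSet_filtration_lt (hγ : Measurable γ) (t : ℝ≥0) :
    MeasurableSet[filtration m γ t] {ω | (t : ℝ≥0∞) < γ ω} :=
  ⟨measurableSet_lt measurable_const hγ, Or.inr (inter_self _)⟩

/-- The restriction of `N t` to `{γ ≤ s}` is already measurable at time `s`, so conditioning leaves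
it unchanged, while it turns `N t` into `N s`. -/
theorem ae_eq_of_martingale_of_le (hγ : Measurable γ) {N : ℝ≥0 → Ω → ℝ}
    (hN : Martingale N (filtration m γ) P) {s t : ℝ≥0} (hst : s ≤ t) :
    ∀ᵐ ω ∂P, γ ω ≤ s → N s ω = N t ω := by
  have h1 := condExp_indicator (hN.integrable t) (measurableSet_filtration_le hγ s)
  have hmeas : Measurable (N t) :=
    (hN.1 t).measurable.mono ((filtration m γ).le t) le_rfl
  rw [condExp_of_stronglyMeasurable ((filtration m γ).le s)
    (stronglyMeasurable_indicator_le hγ s hmeas)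
    ((hN.integrable t).indicator (measurableSet_le hγ measurable_const))] at h1
  filter_upwards [h1, hN.2 s t hst] with ω h2 h3 h4
  have h5 : ω ∈ {ω | γ ω ≤ s} := h4
  rw [indicator_of_mem h5, indicator_of_mem h5, h3] at h2
  exact h2.symm

/-- A right-continuous martingale stays constant from time `γ` on. -/
theorem ae_const_after_of_isUIMartingale (hγ : Measurable γ) {N : ℝ≥0 → Ω → ℝ}
    (hN : IsUIMartingale (filtration m γ) P N) :
    ∀ᵐ ω ∂P, ∀ s t : ℝ≥0, γ ω ≤ s → s ≤ t → N s ω = N t ω := by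
  obtain ⟨D, hDc, hDd⟩ := TopologicalSpace.exists_countable_dense ℝ≥0
  have h1 : ∀ᵐ ω ∂P, ∀ s ∈ D, ∀ t ∈ D, s ≤ t → γ ω ≤ s → N s ω = N t ω := by
    refine (ae_ball_iff hDc).2 fun s _ => (ae_ball_iff hDc).2 fun t _ => ?_
    by_cases hst : s ≤ t
    · filter_upwards [ae_eq_of_martingale_of_le hγ hN.1 hst] with ω hω _ using hω
    · exact Eventually.of_forall fun ω h => absurd h hst
  filter_upwards [h1, hN.2.2] with ω h2 h3
  have h2' : ∀ s ∈ D, ∀ t ∈ D, γ ω ≤ s → γ ω ≤ t → N s ω = N t ω := by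
    intro s hs t ht hγs hγt
    rcases le_total s t with h | h
    · exact h2 s hs t ht h hγs
    · exact (h2 t ht s hs h hγt).symm
  -- Right-continuity: a value different from `N d ω` would persist just to the right of `t`, where
  -- there are points of `D`.
  have h4 : ∀ t d : ℝ≥0, γ ω ≤ t → d ∈ D → γ ω ≤ d → N t ω = N d ω := by
    intro t d ht hd hγd
    have hlim : Tendsto (fun t => N t ω) (𝓝[>] t) (𝓝 (N t ω)) :=
      ((h3 t ENNReal.coe_lt_top).1.mono Ioi_subset_Ici_self)
    by_contra hne
    have h5 : ∀ᶠ u in 𝓝[>] t, N u ω ≠ N d ω := hlim.eventually_ne hne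
    obtain ⟨b, hb, h6⟩ := (mem_nhdsGT_iff_exists_Ioo_subset).1 h5
    obtain ⟨e, heD, he⟩ := hDd.exists_between hb
    exact h6 he (h2' e heD d hd (ht.trans (ENNReal.coe_le_coe.2 he.1.le)) hγd)
  intro s t hs hst
  obtain ⟨d, hd, hdt⟩ := hDd.exists_gt t
  have h5 : γ ω ≤ t := hs.trans (ENNReal.coe_le_coe.2 hst)
  have h6 : γ ω ≤ d := h5.trans (ENNReal.coe_le_coe.2 hdt.le)
  rw [h4 s d hs hd h6, h4 t d h5 hd h6]

/-- Almost surely, `P(γ ≥ γ(ω) ∧ T) > 0` for every `T`. -/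
theorem ae_measure_le_pos {P : Measure Ω} (γ : Ω → ℝ≥0∞) :
    ∀ᵐ ω ∂P, ∀ T : ℝ≥0, (T : ℝ≥0∞) ≤ γ ω → 0 < P {ω' | (T : ℝ≥0∞) ≤ γ ω'} := by
  obtain ⟨D, hDc, hDd⟩ := TopologicalSpace.exists_countable_dense ℝ≥0
  -- `U` is an upper set, so countably many times suffice to test it: the points of `D`, and `sInf
  -- U` itself in case the infimum is attained.
  let U : Set ℝ≥0 := {T | P {ω' | (T : ℝ≥0∞) ≤ γ ω'} = 0}
  have hU : ∀ T ∈ U, ∀ᵐ ω ∂P, γ ω < T := fun T hT =>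
    (measure_eq_zero_iff_ae_notMem.1 hT).mono fun ω hω => not_le.1 hω
  have h1 : ∀ᵐ ω ∂P, ∀ T ∈ D, T ∈ U → γ ω < T := by
    refine (ae_ball_iff hDc).2 fun T _ => ?_
    by_cases hT : T ∈ U
    · exact (hU T hT).mono fun _ h _ => h
    · exact Eventually.of_forall fun _ h => absurd h hT
  have h2 : ∀ᵐ ω ∂P, sInf U ∈ U → γ ω < (sInf U : ℝ≥0) := by
    by_cases hT : sInf U ∈ U
    · exact (hU _ hT).mono fun _ h _ => h
    · exact Eventually.of_forall fun _ h => absurd h hT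
  have hup : ∀ S ∈ U, ∀ T, S ≤ T → T ∈ U := fun S hS T hST =>
    measure_mono_null (fun ω (hω : (T : ℝ≥0∞) ≤ γ ω) => (ENNReal.coe_le_coe.2 hST).trans hω) hS
  filter_upwards [h1, h2] with ω h3 h4 T hT
  by_contra h5
  have hTU : T ∈ U := nonpos_iff_eq_zero.1 (not_lt.1 h5)
  rcases (csInf_le (OrderBot.bddBelow U) hTU).eq_or_lt with h6 | h6
  · exact absurd (h4 (h6 ▸ hTU)) (not_lt.2 (h6 ▸ hT))
  · obtain ⟨e, heD, he1, he2⟩ := hDd.exists_between h6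
    obtain ⟨S, hS, hSe⟩ := exists_lt_of_csInf_lt ⟨T, hTU⟩ he1
    exact absurd (h3 e heD (hup S hS e hSe.le))
      (not_lt.2 ((ENNReal.coe_le_coe.2 he2.le).trans hT))

/-- If `P(γ ≥ g) > 0`, then on `[0, g)` the deterministic part of a martingale is a difference of
bounded monotone functions. -/
theorem exists_monotoneOn_sub_of_martingale (hγ : Measurable γ) {N : ℝ≥0 → Ω → ℝ}
    (hN : Martingale N (filtration m γ) P) {F : ℝ≥0 → ℝ}
    (hF : ∀ (t : ℝ≥0) (ω : Ω), (t : ℝ≥0∞) < γ ω → N t ω = F t) {g : ℝ≥0}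
    (hg : 0 < P {ω | (g : ℝ≥0∞) ≤ γ ω}) :
    ∃ (p q : ℝ≥0 → ℝ) (C : ℝ), MonotoneOn p (Iio g) ∧ MonotoneOn q (Iio g) ∧
      (∀ t < g, |p t| ≤ C) ∧ (∀ t < g, |q t| ≤ C) ∧ ∀ t < g, F t = p t - q t := by
  let f₁ : Ω → ℝ := fun ω => max (N g ω) 0
  let f₂ : Ω → ℝ := fun ω => max (-N g ω) 0
  have i₁ : Integrable f₁ P := (hN.integrable g).pos_part
  have i₂ : Integrable f₂ P := (hN.integrable g).neg_part
  let S : ℝ≥0 → ℝ := fun t => P.real {ω | (t : ℝ≥0∞) < γ ω}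
  have hδ : 0 < P.real {ω | (g : ℝ≥0∞) ≤ γ ω} := ENNReal.toReal_pos hg.ne' (measure_ne_top _ _)
  have hSδ : ∀ t < g, P.real {ω | (g : ℝ≥0∞) ≤ γ ω} ≤ S t := fun t ht =>
    measureReal_mono fun ω (hω : (g : ℝ≥0∞) ≤ γ ω) => (ENNReal.coe_lt_coe.2 ht).trans_le hω
  have hSpos : ∀ t < g, 0 < S t := fun t ht => hδ.trans_le (hSδ t ht)
  have hSanti : ∀ s t, s ≤ t → S t ≤ S s := fun s t hst =>
    measureReal_mono fun ω (hω : (t : ℝ≥0∞) < γ ω) => (ENNReal.coe_le_coe.2 hst).trans_lt hω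
  -- The numerator increases with `t`, while the denominator decreases but stays at least `P(γ ≥ g)
  -- > 0`.
  have block : ∀ u v : Ω → ℝ, Integrable u P → Integrable v P → (∀ ω, 0 ≤ u ω) → (∀ ω, 0 ≤ v ω) →
      MonotoneOn (fun t : ℝ≥0 => (∫ ω, u ω ∂P + ∫ ω in {ω | γ ω ≤ t}, v ω ∂P) / S t) (Iio g) ∧
      ∀ t < g, |(∫ ω, u ω ∂P + ∫ ω in {ω | γ ω ≤ t}, v ω ∂P) / S t| ≤
        (∫ ω, u ω ∂P + ∫ ω, v ω ∂P) / P.real {ω | (g : ℝ≥0∞) ≤ γ ω} := by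
    intro u v hu hv hu0 hv0
    have hu1 : 0 ≤ ∫ ω, u ω ∂P := integral_nonneg hu0
    have hv1 : ∀ t : ℝ≥0, 0 ≤ ∫ ω in {ω | γ ω ≤ t}, v ω ∂P := fun t => integral_nonneg hv0
    refine ⟨fun s hs t ht hst => ?_, fun t ht => ?_⟩
    · refine div_le_div₀ (add_nonneg hu1 (hv1 t)) ?_ (hSpos t ht) (hSanti s t hst)
      refine add_le_add le_rfl ?_
      refine setIntegral_mono_set hv.integrableOn (Eventually.of_forall hv0) ?_
      exact Eventually.of_forall fun ω (hω : γ ω ≤ s) => hω.trans (ENNReal.coe_le_coe.2 hst)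
    · rw [abs_of_nonneg (div_nonneg (add_nonneg hu1 (hv1 t)) (hSpos t ht).le)]
      refine div_le_div₀ (add_nonneg hu1 (integral_nonneg hv0)) ?_ hδ (hSδ t ht)
      refine add_le_add le_rfl ?_
      exact setIntegral_le_integral hv (Eventually.of_forall hv0)
  have h0₁ : ∀ ω, 0 ≤ f₁ ω := fun ω => le_max_right _ _
  have h0₂ : ∀ ω, 0 ≤ f₂ ω := fun ω => le_max_right _ _
  -- The pairing is crossed: passing from `{t < γ}` to its complement changes signs, so the integral
  -- of the negative part over `{γ ≤ t}` is added to `p`, and that of the positive part to `q`.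
  obtain ⟨hp, hpC⟩ := block f₁ f₂ i₁ i₂ h0₁ h0₂
  obtain ⟨hq, hqC⟩ := block f₂ f₁ i₂ i₁ h0₂ h0₁
  refine ⟨_, _, _, hp, hq, hpC, fun t ht => (hqC t ht).trans_eq (by rw [add_comm]),
    fun t ht => ?_⟩
  have hml : MeasurableSet {ω | γ ω ≤ t} := measurableSet_le hγ measurable_const
  have hcompl : {ω | γ ω ≤ (t : ℝ≥0∞)}ᶜ = {ω | (t : ℝ≥0∞) < γ ω} := by ext; simp
  have e1 : ∫ ω in {ω | (t : ℝ≥0∞) < γ ω}, N t ω ∂P = F t * S t := by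
    rw [setIntegral_congr_fun (measurableSet_lt measurable_const hγ)
      (g := fun _ => F t) fun ω hω => hF t ω hω, setIntegral_const, smul_eq_mul, mul_comm]
  have e2 := hN.setIntegral_eq ht.le (measurableSet_filtration_lt hγ t)
  have e3 : ∀ f : Ω → ℝ, Integrable f P →
      ∫ ω in {ω | (t : ℝ≥0∞) < γ ω}, f ω ∂P = ∫ ω, f ω ∂P - ∫ ω in {ω | γ ω ≤ t}, f ω ∂P := by
    intro f hf
    rw [← hcompl, ← integral_add_compl hml hf]
    ring
  have e4 : ∫ ω in {ω | (t : ℝ≥0∞) < γ ω}, N g ω ∂P =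
      ∫ ω in {ω | (t : ℝ≥0∞) < γ ω}, f₁ ω ∂P - ∫ ω in {ω | (t : ℝ≥0∞) < γ ω}, f₂ ω ∂P := by
    rw [← integral_sub i₁.integrableOn i₂.integrableOn]
    refine integral_congr_ae (Eventually.of_forall fun ω => ?_)
    simp only [f₁, f₂]
    rcases le_total 0 (N g ω) with h | h
    · rw [max_eq_left h, max_eq_right (neg_nonpos.2 h), sub_zero]
    · rw [max_eq_right h, max_eq_left (neg_nonneg.2 h), zero_sub, neg_neg]
  rw [e3 f₁ i₁, e3 f₂ i₂] at e4
  have hne := (hSpos t ht).ne'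
  rw [← sub_div, eq_div_iff hne, ← e1, e2, e4]
  ring

/-- The path is cut at `g = γ ω ∧ T`: a difference of bounded monotone functions before, constant
from there to `T`. Almost surely `P(γ ≥ g) > 0`, as the first half requires. -/
theorem ae_boundedVariationOn_of_isUIMartingale (hγ : Measurable γ) {N : ℝ≥0 → Ω → ℝ}
    (hN : IsUIMartingale (filtration m γ) P N) :
    ∀ᵐ ω ∂P, ∀ T : ℝ≥0, BoundedVariationOn (fun s => N s ω) (Icc 0 T) := by
  obtain ⟨F, hF⟩ := exists_eq_before_of_adapted hN.1.1
  filter_upwards [ae_const_after_of_isUIMartingale hγ hN, ae_measure_le_pos (P := P) γ]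
    with ω h1 h2 T
  obtain ⟨g, hg⟩ : ∃ g : ℝ≥0, (g : ℝ≥0∞) = min (γ ω) T :=
    ⟨(min (γ ω) T).toNNReal, ENNReal.coe_toNNReal (min_lt_of_right_lt ENNReal.coe_lt_top).ne⟩
  have hgγ : (g : ℝ≥0∞) ≤ γ ω := hg ▸ min_le_left _ _
  obtain ⟨p, q, C, hp, hq, hpC, hqC, hpq⟩ :=
    exists_monotoneOn_sub_of_martingale hγ hN.1 hF (h2 g hgγ)
  refine boundedVariationOn_of_monotoneOn_sub_of_const hp hq hpC hqC
    (fun t ht => ?_) fun t hgt htT => ?_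
  · rw [← hpq t ht]
    exact hF t ω ((ENNReal.coe_lt_coe.2 ht).trans_le hgγ)
  · rcases le_total (γ ω) T with h | h
    · rw [min_eq_left h] at hg
      exact (h1 g t hg.ge hgt).symm
    · rw [min_eq_right h, ENNReal.coe_inj] at hg
      rw [le_antisymm (hg ▸ htT) hgt]

/-- Every local martingale of a single jump filtration has finite variation. -/
theorem IsLocalMartingale.hasFiniteVariation (hγ : Measurable γ) {X : ℝ≥0 → Ω → ℝ}
    (hX : IsLocalMartingale (filtration m γ) P X) :
    IsFiniteVariationProcess (filtration m γ) P X := by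
  obtain ⟨had, hcad, T, hT, hN⟩ := hX
  choose N hUI hind using hN
  refine ⟨had, ?_⟩
  have h1 := ae_all_iff.2 fun n => ae_boundedVariationOn_of_isUIMartingale hγ (hUI n)
  filter_upwards [hcad, h1, ae_all_iff.2 hind, hT.tendsto_top] with ω h2 h3 h4 h5
  refine ⟨h2, fun t => ?_⟩
  obtain ⟨n, hn⟩ := (h5.eventually (lt_mem_nhds (WithTop.coe_lt_top t))).exists
  unfold BoundedVariationOn
  rw [← eVariationOn.congr (f := fun s => N n s ω)]
  · exact h3 n t
  · intro s hs
    have : ((s : ℝ≥0) : WithTop ℝ≥0) ≤ T n ω := (WithTop.coe_le_coe.2 hs.2).trans hn.le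
    simp only [h4 n s, stoppedProcess, min_eq_left this]
    rfl

theorem IsSemimartingale.hasFiniteVariation (hγ : Measurable γ) {X : ℝ≥0 → Ω → ℝ}
    (hX : IsSemimartingale (filtration m γ) P X) :
    IsFiniteVariationProcess (filtration m γ) P X := by
  obtain ⟨M, A, hM, hA, h⟩ := hX
  have hM' := hM.hasFiniteVariation hγ
  obtain rfl : X = fun t ω => M t ω + A t ω := by ext t ω; exact h t ω
  refine ⟨fun t => (hM'.1 t).add (hA.1 t), ?_⟩
  filter_upwards [hM'.2, hA.2] with ω h1 h2
  exact ⟨h1.1.add h2.1, fun t => boundedVariationOn_add (h1.2 t) (h2.2 t)⟩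

end Martingale

/-! ### Pathwise Lebesgue–Stieltjes integrals -/

/-- The signed measure `μ - ν` is the Lebesgue–Stieltjes measure of `f` on `(0, T]`. -/
def IsStieltjesPair (f : ℝ≥0 → ℝ) (T : ℝ≥0) (μ ν : Measure ℝ≥0) : Prop :=
  ∀ a b, a ≤ b → b ≤ T → f b - f a = μ.real (Ioc a b) - ν.real (Ioc a b)

/-- Freezing `f` after `T` gives bounded variation on the whole half-line; the pair is the Jordan
decomposition of the resulting Stieltjes measure. Right-continuity identifies the right limits with
values of `f`. -/
theorem exists_isStieltjesPair {f : ℝ≥0 → ℝ} (hf : IsCadlag f) {T : ℝ≥0}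
    (hbv : BoundedVariationOn f (Icc 0 T)) :
    ∃ μ ν : Measure ℝ≥0, IsFiniteMeasure μ ∧ IsFiniteMeasure ν ∧ IsStieltjesPair f T μ ν := by
  let φ : ℝ≥0 → ℝ≥0 := fun t => min t T
  have hφ : Monotone φ := fun a b h => min_le_min_right T h
  have hg : BoundedVariationOn (f ∘ φ) univ :=
    ne_top_of_le_ne_top hbv (eVariationOn.comp_le_of_monotoneOn f φ (hφ.monotoneOn _)
      fun t _ => ⟨zero_le, min_le_right _ _⟩)
  have hright : ∀ t, (f ∘ φ).rightLim t = f (φ t) := by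
    intro t
    have hc : ContinuousWithinAt (f ∘ φ) (Ici t) t :=
      ContinuousWithinAt.comp (t := Ici (φ t)) (hf (φ t) ENNReal.coe_lt_top).1
        (by fun_prop) fun s hs => hφ hs
    exact hc.rightLim_eq
  let j := SignedMeasure.toJordanDecomposition hg.vectorMeasure
  refine ⟨j.posPart, j.negPart, j.posPart_finite, j.negPart_finite, fun a b hab hb => ?_⟩
  have := j.posPart_finite
  have := j.negPart_finite
  have h1 : hg.vectorMeasure (Ioc a b) = j.toSignedMeasure (Ioc a b) := by
    rw [SignedMeasure.toSignedMeasure_toJordanDecomposition]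
  rw [hg.vectorMeasure_Ioc hab, hright, hright, JordanDecomposition.toSignedMeasure,
    _root_.sub_apply, Measure.toSignedMeasure_apply_measurable measurableSet_Ioc,
    Measure.toSignedMeasure_apply_measurable measurableSet_Ioc] at h1
  rw [← h1]
  simp only [φ, min_eq_left hb, min_eq_left (hab.trans hb)]

theorem tendsto_setIntegral_of_bounded {μ : Measure ℝ≥0} [IsFiniteMeasure μ] {H : ℕ → ℝ≥0 → ℝ}
    {K : ℝ≥0 → ℝ} {C : ℝ} (s : Set ℝ≥0) (hm : ∀ n, Measurable (H n)) (hC : ∀ n t, |H n t| ≤ C)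
    (hK : ∀ t, Tendsto (fun n => H n t) atTop (𝓝 (K t))) :
    Tendsto (fun n => ∫ t in s, H n t ∂μ) atTop (𝓝 (∫ t in s, K t ∂μ)) :=
  tendsto_integral_of_dominated_convergence (fun _ => C)
    (fun n => (hm n).aestronglyMeasurable) (integrable_const C)
    (fun n => Eventually.of_forall fun t => hC n t) (Eventually.of_forall hK)

/-- Convergence uniformly on compacts in probability implies almost sure pointwise convergence along
a subsequence. -/
theorem TendstoUCP.exists_subseq_ae {P : Measure Ω} {Y : ℕ → ℝ≥0 → Ω → ℝ} {Z : ℝ≥0 → Ω → ℝ}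
    (h : TendstoUCP P Y Z) :
    ∃ φ : ℕ → ℕ, Tendsto φ atTop atTop ∧
      ∀ᵐ ω ∂P, ∀ t, Tendsto (fun k => Y (φ k) t ω) atTop (𝓝 (Z t ω)) := by
  -- Borel–Cantelli: both the horizon `k` and the tolerance `1 / (k + 1)` move with `k`, so one
  -- summable family of events controls every time.
  have h1 : ∀ k : ℕ, ∃ n, k ≤ n ∧
      P {ω | ∃ s ≤ (k : ℝ≥0), 1 / ((k : ℝ) + 1) ≤ |Y n s ω - Z s ω|} ≤ 2⁻¹ ^ k := by
    intro k
    have hpos : (0 : ℝ≥0∞) < 2⁻¹ ^ k := ENNReal.pow_pos (by simp) k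
    have h2 := (h k (1 / ((k : ℝ) + 1)) (by positivity)).eventually (ge_mem_nhds hpos)
    obtain ⟨n, hn⟩ := (h2.and (eventually_ge_atTop k)).exists
    exact ⟨n, hn.2, hn.1⟩
  choose φ hφ hP using h1
  refine ⟨φ, tendsto_atTop_mono hφ tendsto_id, ?_⟩
  have hsum : ∑' k : ℕ, P {ω | ∃ s ≤ (k : ℝ≥0), 1 / ((k : ℝ) + 1) ≤ |Y (φ k) s ω - Z s ω|} ≠ ∞ := by
    refine ne_top_of_le_ne_top ?_ (ENNReal.tsum_le_tsum hP)
    rw [ENNReal.tsum_geometric]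
    simp
  filter_upwards [ae_eventually_notMem hsum] with ω hω t
  rw [tendsto_iff_dist_tendsto_zero]
  refine squeeze_zero' (Eventually.of_forall fun _ => dist_nonneg) ?_
    tendsto_one_div_add_atTop_nhds_zero_nat
  obtain ⟨n, hn⟩ := exists_nat_ge t
  filter_upwards [hω, eventually_ge_atTop n] with k hk hnk
  by_contra hlt
  exact hk ⟨t, hn.trans (Nat.cast_le.2 hnk), (not_le.1 hlt).le⟩

/-- Stochastic integrals of bounded predictable processes are pathwise Lebesgue–Stieltjes
integrals whenever the path of the integrator has a Lebesgue–Stieltjes measure. -/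
theorem IsStochIntegral.ae_eq_stieltjes {𝓕 : Filtration ℝ≥0 m} {P : Measure Ω}
    {X H Y : ℝ≥0 → Ω → ℝ} (h : IsStochIntegral 𝓕 P X H Y) :
    (∃ C : ℝ, ∀ t ω, |H t ω| ≤ C) ∧ (∀ ω, Measurable fun t => H t ω) ∧
    ∀ᵐ ω ∂P, ∀ (T : ℝ≥0) (μ ν : Measure ℝ≥0) [IsFiniteMeasure μ] [IsFiniteMeasure ν],
      IsStieltjesPair (fun t => X t ω) T μ ν → ∀ t ≤ T,
        Y t ω = ∫ s in Ioc 0 t, H s ω ∂μ - ∫ s in Ioc 0 t, H s ω ∂ν := by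
  have hbound : ∀ (S : Set (ℝ≥0 × Ω)) t ω, abs (indicatorProcess S t ω) ≤ 1 := by
    intro S t ω
    by_cases h : (t, ω) ∈ S <;> simp [indicatorProcess, h]
  have hprod : ∀ (B : Set ℝ≥0) (A : Set Ω) (ω : Ω), (fun t => indicatorProcess (B ×ˢ A) t ω) =
      B.indicator (fun _ => A.indicator (fun _ => (1 : ℝ)) ω) := by
    intro B A ω
    ext t
    by_cases h1 : t ∈ B <;> by_cases h2 : ω ∈ A <;> simp [indicatorProcess, h1, h2]
  -- The bound and the measurability of the sections are carried along for integrability and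
  -- dominated convergence. The measures are quantified inside the almost-sure statement, so they
  -- may depend on the path.
  induction h with
  | zero A hA =>
    refine ⟨⟨1, hbound _⟩, fun ω => ?_, Eventually.of_forall fun ω T μ ν _ _ _ t _ => ?_⟩
    · rw [hprod]
      exact measurable_const.indicator (measurableSet_singleton 0)
    · have h0 : ∀ ρ : Measure ℝ≥0,
          ∫ s in Ioc 0 t, indicatorProcess ({0} ×ˢ A) s ω ∂ρ = 0 := fun ρ =>
        setIntegral_eq_zero_of_forall_eq_zero fun s hs => by
          have := hs.1.ne'
          simp [indicatorProcess, this]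
      rw [h0, h0, sub_zero]
  | elementary s A hA =>
    refine ⟨⟨1, hbound _⟩, fun ω => ?_, Eventually.of_forall fun ω T μ ν _ _ hμν t ht => ?_⟩
    · rw [hprod]
      exact measurable_const.indicator measurableSet_Ioi
    · have h0 : ∀ ρ : Measure ℝ≥0, ∫ u in Ioc 0 t, indicatorProcess (Ioi s ×ˢ A) u ω ∂ρ =
          ρ.real (Ioc (min t s) t) * A.indicator (fun _ => (1 : ℝ)) ω := by
        intro ρ
        have h1 : Ioc 0 t ∩ Ioi s = Ioc (min t s) t := by
          ext u
          simp only [mem_inter_iff, mem_Ioc, mem_Ioi, min_lt_iff]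
          constructor
          · exact fun h => ⟨Or.inr h.2, h.1.2⟩
          · rintro ⟨h | h, h'⟩
            · exact absurd h (not_lt.2 h')
            · exact ⟨⟨bot_le.trans_lt h, h'⟩, h⟩
        rw [show (fun u => indicatorProcess (Ioi s ×ˢ A) u ω) = _ from hprod _ _ _,
          setIntegral_indicator measurableSet_Ioi, h1, setIntegral_const, smul_eq_mul]
      rw [h0, h0, ← sub_mul, ← hμν _ _ (min_le_left t s) ht]
      by_cases hω : ω ∈ A <;> simp [hω]
  | add H K Y Z hH hK ihH ihK =>
    obtain ⟨⟨C, hC⟩, hm, hY⟩ := ihH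
    obtain ⟨⟨D, hD⟩, hm', hZ⟩ := ihK
    refine ⟨⟨C + D, fun t ω => (abs_add_le _ _).trans (add_le_add (hC t ω) (hD t ω))⟩,
      fun ω => (hm ω).add (hm' ω), ?_⟩
    filter_upwards [hY, hZ] with ω h1 h2 T μ ν _ _ hμν t ht
    have hint : ∀ ρ : Measure ℝ≥0, IsFiniteMeasure ρ →
        ∫ s in Ioc 0 t, (H s ω + K s ω) ∂ρ =
          ∫ s in Ioc 0 t, H s ω ∂ρ + ∫ s in Ioc 0 t, K s ω ∂ρ := fun ρ _ =>
      integral_add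
        (Integrable.of_bound (hm ω).aestronglyMeasurable C (Eventually.of_forall fun s => hC s ω))
        (Integrable.of_bound (hm' ω).aestronglyMeasurable D (Eventually.of_forall fun s => hD s ω))
    rw [hint μ inferInstance, hint ν inferInstance, h1 T μ ν hμν t ht, h2 T μ ν hμν t ht]
    ring
  | smul c H Y hH ih =>
    obtain ⟨⟨C, hC⟩, hm, hY⟩ := ih
    refine ⟨⟨|c| * C, fun t ω => ?_⟩, fun ω => (hm ω).const_mul c, ?_⟩
    · rw [abs_mul]
      exact mul_le_mul_of_nonneg_left (hC t ω) (abs_nonneg c)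
    · filter_upwards [hY] with ω h1 T μ ν _ _ hμν t ht
      rw [integral_const_mul, integral_const_mul, h1 T μ ν hμν t ht]
      ring
  | limit H Y K Z C hH hC hK hZ ih =>
    refine ⟨⟨C, fun t ω => le_of_tendsto (hK t ω).abs (Eventually.of_forall fun n => hC n t ω)⟩,
      fun ω => measurable_of_tendsto_metrizable (fun n => (ih n).2.1 ω)
        (tendsto_pi_nhds.2 fun t => hK t ω), ?_⟩
    obtain ⟨φ, hφ, hlim⟩ := hZ.exists_subseq_ae
    filter_upwards [hlim, ae_all_iff.2 fun n => (ih n).2.2] with ω h1 h2 T μ ν _ _ hμν t ht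
    have hint : ∀ ρ : Measure ℝ≥0, IsFiniteMeasure ρ →
        Tendsto (fun k => ∫ s in Ioc 0 t, H (φ k) s ω ∂ρ) atTop
          (𝓝 (∫ s in Ioc 0 t, K s ω ∂ρ)) := fun ρ _ =>
      tendsto_setIntegral_of_bounded (Ioc 0 t) (fun k => (ih (φ k)).2.1 ω)
        (fun k s => hC (φ k) s ω) fun s => (hK s ω).comp hφ
    refine tendsto_nhds_unique (h1 t) ?_
    exact ((hint μ inferInstance).sub (hint ν inferInstance)).congr
      fun k => (h2 (φ k) T μ ν hμν t ht).symm

/-! ### `σ`-martingales -/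

section SigmaMartingale

variable {P : Measure Ω} [IsProbabilityMeasure P] {γ : Ω → ℝ≥0∞}

/-- On a fixed path the integrals over `S n` tend to `M u - M 0`, because the indicators tend to `1`
boundedly. Each integral is constant after `γ`, hence so is the limit. -/
theorem IsSigmaMartingale.ae_const_after (hγ : Measurable γ) {M : ℝ≥0 → Ω → ℝ}
    (hM : IsSigmaMartingale (filtration m γ) P M) :
    ∀ᵐ ω ∂P, ∀ s t : ℝ≥0, γ ω ≤ s → s ≤ t → M s ω = M t ω := by
  obtain ⟨hsemi, S, hmono, hunion, -, hS⟩ := hM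
  choose Y hY hUI using hS
  have hst := fun n => (hY n).ae_eq_stieltjes
  filter_upwards [(hsemi.hasFiniteVariation hγ).2, ae_all_iff.2 fun n => (hst n).2.2,
    ae_all_iff.2 fun n => ae_const_after_of_isUIMartingale hγ (hUI n)] with ω h1 h2 h3 s t hs hst'
  obtain ⟨μ, ν, _, _, hμν⟩ := exists_isStieltjesPair h1.1 (h1.2 t)
  have hb : ∀ n u, abs (indicatorProcess (S n) u ω) ≤ 1 := by
    intro n u
    by_cases h : (u, ω) ∈ S n <;> simp [indicatorProcess, h]
  have hlim : ∀ u, Tendsto (fun n => indicatorProcess (S n) u ω) atTop (𝓝 1) := by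
    intro u
    obtain ⟨n, hn⟩ := mem_iUnion.1 (hunion ▸ mem_univ (u, ω) : (u, ω) ∈ ⋃ n, S n)
    refine tendsto_const_nhds.congr' ?_
    filter_upwards [eventually_ge_atTop n] with k hk
    have := hmono hk hn
    simp [indicatorProcess, this]
  have hint : ∀ ρ : Measure ℝ≥0, IsFiniteMeasure ρ → ∀ u,
      Tendsto (fun n => ∫ v in Ioc 0 u, indicatorProcess (S n) v ω ∂ρ) atTop
        (𝓝 (ρ.real (Ioc 0 u))) := by
    intro ρ _ u
    have := tendsto_setIntegral_of_bounded (μ := ρ) (K := fun _ => 1) (Ioc 0 u)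
      (fun n => (hst n).2.1 ω) hb hlim
    simpa using this
  have hYlim : ∀ u ≤ t, Tendsto (fun n => Y n u ω) atTop (𝓝 (M u ω - M 0 ω)) := by
    intro u hu
    rw [hμν 0 u zero_le hu]
    exact ((hint μ inferInstance u).sub (hint ν inferInstance u)).congr
      fun n => (h2 n t μ ν hμν u hu).symm
  have := tendsto_nhds_unique (hYlim s hst')
    ((hYlim t le_rfl).congr fun n => (h3 n s t hs hst').symm)
  linarith

theorem IsSigmaMartingale.exists_eq (hγ : Measurable γ) {M : ℝ≥0 → Ω → ℝ}
    (hM : IsSigmaMartingale (filtration m γ) P M) :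
    ∃ (F : ℝ≥0 → ℝ) (L : Ω → ℝ), Measurable L ∧ HasFiniteVariationBefore P γ F ∧
      Indistinguishable P M (fun t ω =>
        F t * {ω | (t : ℝ≥0∞) < γ ω}.indicator (fun _ => (1 : ℝ)) ω +
        L ω * {ω | γ ω ≤ (t : ℝ≥0∞)}.indicator (fun _ => (1 : ℝ)) ω) := by
  have hFV := hM.1.hasFiniteVariation hγ
  obtain ⟨F, hF⟩ := exists_eq_before_of_adapted hFV.1
  -- The `limsup` over integer times is a real random variable defined everywhere. Almost surely on
  -- `{γ < ∞}` the sequence is eventually constant and this is its final value; on `{γ = ∞}` the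
  -- value never enters.
  refine ⟨F, fun ω => limsup (fun n : ℕ => M n ω) atTop,
    Measurable.limsup fun n => (hFV.1 n).measurable.mono ((filtration m γ).le _) le_rfl,
    hasFiniteVariationBefore_of_isFiniteVariationProcess hγ hFV
      fun t ω h => hF t ω (h.trans_le (min_le_left _ _)), ?_⟩
  filter_upwards [hM.ae_const_after hγ] with ω hω t
  rcases lt_or_ge (t : ℝ≥0∞) (γ ω) with h | h
  · have h' : ¬ γ ω ≤ t := not_le.2 h
    simp [indicator, h, h', hF t ω h]
  · have h' : ¬ (t : ℝ≥0∞) < γ ω := not_lt.2 h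
    have hlim : Tendsto (fun n : ℕ => M n ω) atTop (𝓝 (M t ω)) := by
      obtain ⟨n, hn⟩ := exists_nat_ge t
      refine tendsto_const_nhds.congr' ?_
      filter_upwards [eventually_ge_atTop n] with k hk
      exact hω t k h (hn.trans (Nat.cast_le.2 hk))
    simp [indicator, h, h', hlim.limsup_eq]

end SigmaMartingale

end SingleJump

theorem proposition2 {Ω : Type*} {m : MeasurableSpace Ω} (P : Measure Ω) [IsProbabilityMeasure P]
    (γ : Ω → ℝ≥0∞) (hγ : Measurable γ) (hpos : 0 < P {ω | 0 < γ ω}) :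
    -- (i) adapted processes are deterministic strictly before `γ ∧ t_G`
    ((∀ X : ℝ≥0 → Ω → ℝ, StronglyAdapted (SingleJump.filtration m γ) X →
        ∃ F : ℝ≥0 → ℝ, ∀ (t : ℝ≥0) (ω : Ω),
          (t : ℝ≥0∞) < min (γ ω) (SingleJump.rightEndpoint P γ) → X t ω = F t) ∧
      (∀ X Y : ℝ≥0 → Ω → ℝ, StronglyAdapted (SingleJump.filtration m γ) X →
        StronglyAdapted (SingleJump.filtration m γ) Y →
        (∀ t : ℝ≥0, ∀ᵐ ω ∂P, X t ω = Y t ω) →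
        ∀ (t : ℝ≥0) (ω : Ω),
          (t : ℝ≥0∞) < min (γ ω) (SingleJump.rightEndpoint P γ) → X t ω = Y t ω)) ∧
    -- (ii) predictable processes are deterministic up to and including `γ`
    (∀ Y : ℝ≥0 → Ω → ℝ, IsStronglyPredictable (SingleJump.filtration m γ) Y →
        ∃ C : ℝ≥0 → ℝ, Measurable C ∧ ∀ t ∈ SingleJump.timeSet P γ, ∀ ω : Ω,
          (t : ℝ≥0∞) ≤ γ ω → 0 < γ ω → Y t ω = C t) ∧
    -- (iii) the function in (i) has finite variation if the process has
    (∀ X : ℝ≥0 → Ω → ℝ, SingleJump.IsFiniteVariationProcess (SingleJump.filtration m γ) P X →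
        ∀ F : ℝ≥0 → ℝ, (∀ (t : ℝ≥0) (ω : Ω),
          (t : ℝ≥0∞) < min (γ ω) (SingleJump.rightEndpoint P γ) → X t ω = F t) →
        SingleJump.HasFiniteVariationBefore P γ F) ∧
    -- (iv) semimartingales have finite variation
    (∀ X : ℝ≥0 → Ω → ℝ, SingleJump.IsSemimartingale (SingleJump.filtration m γ) P X →
        SingleJump.IsFiniteVariationProcess (SingleJump.filtration m γ) P X) ∧
    -- (v) the form of `σ`-martingales
    (∀ M : ℝ≥0 → Ω → ℝ, SingleJump.IsSigmaMartingale (SingleJump.filtration m γ) P M →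
        ∃ (F : ℝ≥0 → ℝ) (L : Ω → ℝ), Measurable L ∧
          SingleJump.HasFiniteVariationBefore P γ F ∧
          SingleJump.Indistinguishable P M (fun t ω =>
            F t * {ω | (t : ℝ≥0∞) < γ ω}.indicator (fun _ => (1 : ℝ)) ω +
            L ω * {ω | γ ω ≤ (t : ℝ≥0∞)}.indicator (fun _ => (1 : ℝ)) ω)) := by
  refine ⟨⟨fun X hX => ?_, fun X Y hX hY hXY t ω h =>
      SingleJump.eq_before_of_modification hγ hX hY hXY t ω h⟩, fun Y hY => ?_,
    fun X hX F hF => SingleJump.hasFiniteVariationBefore_of_isFiniteVariationProcess hγ hX hF,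
    fun X hX => hX.hasFiniteVariation hγ, fun M hM => hM.exists_eq hγ⟩
  · obtain ⟨F, hF⟩ := SingleJump.exists_eq_before_of_adapted hX
    exact ⟨F, fun t ω h => hF t ω (h.trans_le (min_le_left _ _))⟩
  · obtain ⟨C, hC, h⟩ := SingleJump.exists_eq_upto_of_predictable hY
    exact ⟨C, hC, fun t _ ω => h t ω⟩
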